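/- **Theorem (CSR-representation).** Work in max algebra, i.e. over the nonnegative reals with $a\oplus b=\max(a,b)$ and the usual product; all matrix products and powers are max-algebraic, $B^0=I$. Let $A=(a_{ij})\in\mathbb{R}_+^{n\times n}$. Let $\mathcal D(A)$ be the digraph on $\{1,\dots,n\}$ with an edge $(i,j)$ whenever $a_{ij}\neq 0$, and let $\lambda(A)=\max_{1\le k\le n}\bigl(\max_i (A^k)_{ii}\bigr)^{1/k}$ be its maximum cycle geometric mean. A cycle of $\mathcal D(A)$ is critical if the geometric mean of its edge weights equals $\lambda(A)$. Nodes and edges on critical cycles are called critical and form the critical digraph $\mathcal C(A)$. Suppose that * $A$ is irreducible ($\mathcal D(A)$ is strongly connected), * $A$ is definite ($\lambda(A)=1$), * $A$ is visualized ($a_{ij}\le 1$ for all $i,j$, and $a_{ij}=1$ for every critical edge $(i,j)$). Let $\gamma$ be the cyclicity of $\mathcal C(A)$, i.e. the least common multiple, over the strongly connected components of $\mathcal C(A)$, of the greatest common divisor of the lengths of all cycles of the component. For $B\in\mathbb{R}_+^{n\times n}$ let $B^*=\bigoplus_{k\ge 0}B^k$ (where finite), and let $Q(B)$ be the matrix with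 entries $\bigoplus_{k} b^*_{ik}b^*_{kj}$, where $k$ runs over the critical nodes of $B$. Let $C$ and $R$ consist of the columns, respectively rows, of $Q(A^\gamma)$ whose indices are critical nodes of $A$. Let $S$ be the Boolean matrix indexed by the critical nodes of $A$, with $s_{ij}=1$ if $(i,j)$ is a critical edge of $A$ and $s_{ij}=0$ otherwise. Then there is an integer $T\ge 0$ such that $A^{t\gamma}=Q(A^\gamma)$ for all integers $t\ge 0$ with $t\gamma\ge T$, and $A^{r+\gamma}=A^r$ for all $r\ge T$. Let $T(A)$ be the least such $T$. The matrices $C$ and $R$ are also the critical columns and rows of $(A^\gamma)^*$, and for all integers $r\ge T(A)$ and $l\ge 0$ with $r\equiv l \pmod{\gamma}$, $$A^r=C\otimes S^l\otimes R.$$ -/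

import Mathlib

open scoped NNReal

/-! Max algebra: the semiring of nonnegative reals with addition `max` and the usual product. -/

namespace MaxAlg

noncomputable section

/-- Max-algebraic matrix product: `(A ⊗ B) i j = max_k (A i k * B k j)`
(the maximum of an empty family is `0`). -/
def maxMul {l m n : Type*} [Fintype m] (A : Matrix l m ℝ≥0) (B : Matrix m n ℝ≥0) :
    Matrix l n ℝ≥0 :=
  Matrix.of fun i j => Finset.univ.sup fun k => A i k * B k j

variable {ι : Type*} [Fintype ι] [DecidableEq ι]

/-- Max-algebraic powers; `A ^ 0` is the identity matrix. -/
def maxPow (A : Matrix ι ι ℝ≥0) : ℕ → Matrix ι ι ℝ≥0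
  | 0 => 1
  | k + 1 => maxMul (maxPow A k) A

/-- `Tr_⊕ A = max_i A i i`. -/
def maxTrace (A : Matrix ι ι ℝ≥0) : ℝ≥0 :=
  Finset.univ.sup fun i => A i i

/-- `λ(A) = max_{1 ≤ k ≤ n} (Tr_⊕ A^k)^{1/k}`, the largest max-algebraic eigenvalue, equal to the
maximum cycle geometric mean. -/
def eigen (A : Matrix ι ι ℝ≥0) : ℝ≥0 :=
  (Finset.Icc 1 (Fintype.card ι)).sup fun k => maxTrace (maxPow A k) ^ (1 / (k : ℝ))

/-- `A` is definite if `λ(A) = 1`. -/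
def Definite (A : Matrix ι ι ℝ≥0) : Prop :=
  eigen A = 1

/-- Kleene star `A* = I ⊕ A ⊕ A² ⊕ ⋯`, entrywise supremum of all powers. It is used only where
this supremum is finite. -/
def kleeneStar (A : Matrix ι ι ℝ≥0) : Matrix ι ι ℝ≥0 :=
  Matrix.of fun i j => ⨆ k : ℕ, maxPow A k i j

/-! ### Digraphs -/

section Digraphs

variable {V : Type*}

/-- `w 0, w 1, …, w k` is a path with `k` edges (nodes may be repeated). -/
def IsPath (G : Digraph V) {k : ℕ} (w : Fin (k + 1) → V) : Prop :=
  ∀ t : Fin k, G.Adj (w t.castSucc) (w t.succ)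

/-- A cycle: a path with at least one edge whose first and last nodes agree. -/
def IsCycle (G : Digraph V) {k : ℕ} (w : Fin (k + 1) → V) : Prop :=
  0 < k ∧ IsPath G w ∧ w 0 = w (Fin.last k)

/-- There is a path (possibly with no edges) from `u` to `v`. -/
def Reachable (G : Digraph V) (u v : V) : Prop :=
  ∃ (k : ℕ) (w : Fin (k + 1) → V), IsPath G w ∧ w 0 = u ∧ w (Fin.last k) = v

/-- Every node can be reached from every node. -/
def StronglyConnected (G : Digraph V) : Prop :=
  ∀ u v : V, Reachable G u v

/-- `u` and `v` lie in the same strongly connected component. -/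
def SameComponent (G : Digraph V) (u v : V) : Prop :=
  Reachable G u v ∧ Reachable G v u

/-- The cyclicity of the strongly connected component of `v`: the greatest natural number that
divides the lengths of all cycles of this component. (It is used for components which contain
cycles, so that this maximum exists.) -/
def componentCyclicity (G : Digraph V) (v : V) : ℕ :=
  sSup {d : ℕ | ∀ (k : ℕ) (w : Fin (k + 1) → V),
    IsCycle G w → (∀ t, SameComponent G v (w t)) → d ∣ k}

/-- The cyclicity of a digraph: the least common multiple of the cyclicities of its strongly
connected components (each component being visited once for each of its nodes). -/
def cyclicity [Fintype V] (G : Digraph V) : ℕ :=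
  Finset.univ.lcm fun v => componentCyclicity G v

end Digraphs

/-! ### The critical digraph -/

/-- The digraph `D(A)`, with an edge `(i, j)` whenever `A i j ≠ 0`. -/
def digraph (A : Matrix ι ι ℝ≥0) : Digraph ι :=
  ⟨fun i j => A i j ≠ 0⟩

/-- `A` is irreducible if `D(A)` is strongly connected. -/
def Irred (A : Matrix ι ι ℝ≥0) : Prop :=
  StronglyConnected (digraph A)

/-- The weight of a path: the product of the weights `A i j` of its edges. -/
def pathWeight (A : Matrix ι ι ℝ≥0) {k : ℕ} (w : Fin (k + 1) → ι) : ℝ≥0 :=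
  ∏ t : Fin k, A (w t.castSucc) (w t.succ)

/-- A cycle of `D(A)` is critical if its geometric mean equals `λ(A)`. -/
def IsCriticalCycle (A : Matrix ι ι ℝ≥0) {k : ℕ} (w : Fin (k + 1) → ι) : Prop :=
  IsCycle (digraph A) w ∧ pathWeight A w ^ (1 / (k : ℝ)) = eigen A

/-- An edge is critical if it belongs to a critical cycle. -/
def IsCriticalEdge (A : Matrix ι ι ℝ≥0) (i j : ι) : Prop :=
  ∃ (k : ℕ) (w : Fin (k + 1) → ι), IsCriticalCycle A w ∧
    ∃ t : Fin k, w t.castSucc = i ∧ w t.succ = j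

/-- A node is critical if it belongs to a critical cycle. -/
def IsCriticalNode (A : Matrix ι ι ℝ≥0) (i : ι) : Prop :=
  ∃ (k : ℕ) (w : Fin (k + 1) → ι), IsCriticalCycle A w ∧ ∃ t, w t = i

open Classical in
/-- The set `N_c(A)` of critical nodes. -/
def criticalNodes (A : Matrix ι ι ℝ≥0) : Finset ι :=
  Finset.univ.filter fun i => IsCriticalNode A i

/-- The critical digraph `C(A)`: the critical nodes with the critical edges. -/
def criticalDigraph (A : Matrix ι ι ℝ≥0) : Digraph (criticalNodes A) :=
  ⟨fun i j => IsCriticalEdge A i j⟩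

/-- `γ`, the cyclicity of the critical digraph of `A`. -/
def gam (A : Matrix ι ι ℝ≥0) : ℕ :=
  cyclicity (criticalDigraph A)

/-- `A` is visualized: all entries are at most `1`, and those on critical edges are `1`. (Used for
definite `A`.) -/
def Visualized (A : Matrix ι ι ℝ≥0) : Prop :=
  (∀ i j, A i j ≤ 1) ∧ ∀ i j, IsCriticalEdge A i j → A i j = 1

open Classical in
/-- The critical matrix `A^{[C]}`, with entry `1` on critical edges and `0` elsewhere. -/
def criticalMatrix (A : Matrix ι ι ℝ≥0) : Matrix ι ι ℝ≥0 :=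
  Matrix.of fun i j => if IsCriticalEdge A i j then 1 else 0

/-- The spectral projector `Q(A)`, `q i j = max_k (a* i k * a* k j)` over critical nodes `k`. -/
def spectralProjector (A : Matrix ι ι ℝ≥0) : Matrix ι ι ℝ≥0 :=
  Matrix.of fun i j => (criticalNodes A).sup fun k => kleeneStar A i k * kleeneStar A k j

/-- The columns of `B` whose indices are critical nodes of `A`. -/
def criticalColumns (A B : Matrix ι ι ℝ≥0) : Matrix ι (criticalNodes A) ℝ≥0 :=
  B.submatrix id Subtype.val

/-- The rows of `B` whose indices are critical nodes of `A`. -/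
def criticalRows (A B : Matrix ι ι ℝ≥0) : Matrix (criticalNodes A) ι ℝ≥0 :=
  B.submatrix Subtype.val id

/-- `C`, the critical columns of `Q(A^γ)`. -/
def matC (A : Matrix ι ι ℝ≥0) : Matrix ι (criticalNodes A) ℝ≥0 :=
  criticalColumns A (spectralProjector (maxPow A (gam A)))

/-- `S`, the critical matrix `A^{[C]}` restricted to the critical nodes (its other entries
vanish). -/
def matS (A : Matrix ι ι ℝ≥0) : Matrix (criticalNodes A) (criticalNodes A) ℝ≥0 :=
  (criticalMatrix A).submatrix Subtype.val Subtype.val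

/-- `R`, the critical rows of `Q(A^γ)`. -/
def matR (A : Matrix ι ι ℝ≥0) : Matrix (criticalNodes A) ι ℝ≥0 :=
  criticalRows A (spectralProjector (maxPow A (gam A)))

/-- From the exponent `T` on, the powers of `A` are periodic with period `γ`, and those whose
exponent is a multiple of `γ` equal `Q(A^γ)`. -/
def IsTransient (A : Matrix ι ι ℝ≥0) (T : ℕ) : Prop :=
  (∀ t : ℕ, T ≤ t * gam A → maxPow A (t * gam A) = spectralProjector (maxPow A (gam A))) ∧
    ∀ r : ℕ, T ≤ r → maxPow A (r + gam A) = maxPow A r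

/-- The transient `T(A)`: the least `T` as above. -/
def transient (A : Matrix ι ι ℝ≥0) : ℕ :=
  sInf {T : ℕ | IsTransient A T}

end

end MaxAlg

/-! Entries of `A^r` are the largest weights of walks with `r` edges, and no edge weighs more than
1. For large `r ≡ l` mod `γ`, `A^r` and `C ⊗ S^l ⊗ R` are compared entrywise.

Lower bound (`eventually_csr_le`): a nonzero entry of the product is the weight of a walk of length
`γa` from `i` to `c`, then a critical walk of length `l` to `d`, then a walk of length `γb` to `j`.
Critical edges weigh 1, and `c` has critical closed walks of every large length divisible by `γ`, so
the walk can be lengthened to `r` edges without loss.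

Upper bound (`eventually_maxPow_le_csr`): an optimal walk may meet a critical node; then critical
walks of weight 1 adjust the lengths of its two halves to multiples of `γ` (`maxPow_mul_le_csr`).
Otherwise its weight decays geometrically, since a cycle of ones would be critical, and falls below
every positive entry. Where the product vanishes, irreducibility makes `A^r` vanish too
(`csr_ne_zero`).

The finitely many residues mod `γ` share one threshold, and periodicity carries the identity down to
`T(A)`. -/

namespace MaxAlg

/-! ### Max-algebraic products -/

section Products

variable {l m n p : Type*} [Fintype m] [Fintype n]

theorem mul_le_maxMul (A : Matrix l m ℝ≥0) (B : Matrix m p ℝ≥0) (i : l) (k : m) (j : p) :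
    A i k * B k j ≤ maxMul A B i j :=
  Finset.le_sup (f := fun k => A i k * B k j) (Finset.mem_univ k)

theorem maxMul_le {A : Matrix l m ℝ≥0} {B : Matrix m p ℝ≥0} {i : l} {j : p} {x : ℝ≥0}
    (h : ∀ k, A i k * B k j ≤ x) : maxMul A B i j ≤ x :=
  Finset.sup_le fun k _ => h k

theorem exists_maxMul_eq {A : Matrix l m ℝ≥0} {B : Matrix m p ℝ≥0} {i : l} {j : p}
    (h : maxMul A B i j ≠ 0) : ∃ k, maxMul A B i j = A i k * B k j := by
  rcases isEmpty_or_nonempty m with hm | hm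
  · exact absurd (by simp [maxMul]) h
  · obtain ⟨k, -, hk⟩ := Finset.exists_mem_eq_sup (Finset.univ : Finset m)
      Finset.univ_nonempty fun k => A i k * B k j
    exact ⟨k, hk⟩

theorem maxMul_assoc (A : Matrix l m ℝ≥0) (B : Matrix m n ℝ≥0) (C : Matrix n p ℝ≥0) :
    maxMul (maxMul A B) C = maxMul A (maxMul B C) := by
  ext i j
  simp only [maxMul, Matrix.of_apply, NNReal.finset_sup_mul, NNReal.mul_finset_sup, mul_assoc]
  rw [Finset.sup_comm]

theorem maxMul_one [DecidableEq m] (A : Matrix l m ℝ≥0) : maxMul A 1 = A := by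
  ext i j
  congr 1
  refine le_antisymm (maxMul_le fun k => ?_) ?_
  · rcases eq_or_ne k j with rfl | h
    · simp
    · simp [Matrix.one_apply_ne h]
  · simpa using mul_le_maxMul A 1 i j j

theorem one_maxMul [DecidableEq m] (A : Matrix m p ℝ≥0) : maxMul 1 A = A := by
  ext i j
  congr 1
  refine le_antisymm (maxMul_le fun k => ?_) ?_
  · rcases eq_or_ne i k with rfl | h
    · simp
    · simp [Matrix.one_apply_ne h]
  · simpa using mul_le_maxMul 1 A i i j

end Products

/-! ### Powers as optimal walks, and the Kleene star -/

section Powers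

variable {ι : Type*} [Fintype ι] [DecidableEq ι] (A : Matrix ι ι ℝ≥0)

theorem maxPow_one : maxPow A 1 = A := one_maxMul A

theorem maxPow_add (a b : ℕ) : maxPow A (a + b) = maxMul (maxPow A a) (maxPow A b) := by
  induction b with
  | zero => exact (maxMul_one _).symm
  | succ b ih =>
    rw [← add_assoc, maxPow, ih, maxMul_assoc]
    rfl

theorem maxPow_maxPow (a b : ℕ) : maxPow (maxPow A a) b = maxPow A (a * b) := by
  induction b with
  | zero => rfl
  | succ b ih => rw [maxPow, ih, Nat.mul_succ, maxPow_add]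

theorem maxPow_mul_le (a b : ℕ) (i k j : ι) :
    maxPow A a i k * maxPow A b k j ≤ maxPow A (a + b) i j := by
  rw [maxPow_add]
  exact mul_le_maxMul _ _ _ _ _

theorem maxPow_mul_ne_zero {a b : ℕ} {i k j : ι} (h₁ : maxPow A a i k ≠ 0)
    (h₂ : maxPow A b k j ≠ 0) : maxPow A (a + b) i j ≠ 0 :=
  ((pos_iff_ne_zero.2 (mul_ne_zero h₁ h₂)).trans_le (maxPow_mul_le A a b i k j)).ne'

theorem maxPow_zero_self (i : ι) : maxPow A 0 i i = 1 := by simp [maxPow]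

theorem pow_maxPow_self_le (k m : ℕ) (i : ι) :
    maxPow A k i i ^ m ≤ maxPow A (k * m) i i := by
  induction m with
  | zero => simp [maxPow_zero_self]
  | succ m ih =>
    rw [pow_succ, Nat.mul_succ]
    exact (mul_le_mul_left ih _).trans (maxPow_mul_le A _ _ i i i)

theorem maxPow_self_mul_ne_zero {k : ℕ} {i : ι} (h : maxPow A k i i ≠ 0) (m : ℕ) :
    maxPow A (k * m) i i ≠ 0 :=
  ((pos_iff_ne_zero.2 (pow_ne_zero m h)).trans_le (pow_maxPow_self_le A k m i)).ne'

variable {A}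

theorem maxPow_le_one (hA : ∀ i j, A i j ≤ 1) (k : ℕ) (i j : ι) : maxPow A k i j ≤ 1 := by
  induction k generalizing j with
  | zero =>
    rcases eq_or_ne i j with rfl | h
    · simp [maxPow]
    · simp [maxPow, Matrix.one_apply_ne h]
  | succ k ih => exact maxMul_le fun m => mul_le_one' (ih m) (hA m j)

theorem prod_le_maxPow (f : ℕ → ι) (s k : ℕ) :
    ∏ t ∈ Finset.range k, A (f (s + t)) (f (s + t + 1)) ≤ maxPow A k (f s) (f (s + k)) := by
  induction k with
  | zero =>
    change _ ≤ maxPow A 0 (f s) (f s)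
    rw [maxPow_zero_self]
    simp
  | succ k ih =>
    rw [Finset.prod_range_succ]
    exact (mul_le_mul_left ih _).trans (mul_le_maxMul _ _ _ _ _)

theorem exists_prod_eq_maxPow {k : ℕ} {i j : ι} (h : maxPow A k i j ≠ 0) :
    ∃ f : ℕ → ι, f 0 = i ∧ f k = j ∧
      maxPow A k i j = ∏ t ∈ Finset.range k, A (f t) (f (t + 1)) := by
  induction k generalizing j with
  | zero =>
    have hij : i = j := by
      by_contra hij
      exact h (by simp [maxPow, Matrix.one_apply_ne hij])
    subst hij
    exact ⟨fun _ => i, rfl, rfl, by simp [maxPow]⟩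
  | succ k ih =>
    obtain ⟨m, hm⟩ := exists_maxMul_eq h
    have hm' : maxPow A (k + 1) i j = maxPow A k i m * A m j := hm
    obtain ⟨f, h0, hk, hf⟩ := ih (j := m) fun h0 => h (by rw [hm', h0, zero_mul])
    refine ⟨fun t => if t ≤ k then f t else j, by simpa using h0, by simp, ?_⟩
    rw [hm', Finset.prod_range_succ, hf]
    congr 1
    · refine Finset.prod_congr rfl fun t ht => ?_
      have := Finset.mem_range.1 ht
      simp [this.le, Nat.succ_le_of_lt this]
    · simp [hk]

/-- Cutting out a cycle shows that long walks are not needed for the Kleene star. -/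
theorem exists_lt_maxPow_le (hA : ∀ i j, A i j ≤ 1) {k : ℕ} (hk : Fintype.card ι ≤ k) (i j : ι) :
    ∃ k' < k, maxPow A k i j ≤ maxPow A k' i j := by
  have hcard : 0 < Fintype.card ι := Fintype.card_pos_iff.2 ⟨i⟩
  by_cases h : maxPow A k i j = 0
  · exact ⟨0, by omega, by simp [h]⟩
  obtain ⟨f, rfl, rfl, hf⟩ := exists_prod_eq_maxPow h
  obtain ⟨x, y, hxy, hfxy⟩ := Fintype.exists_ne_map_eq_of_card_lt
    (fun t : Fin (k + 1) => f t) (by simpa using Nat.lt_succ_of_le hk)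
  wlog hlt : x < y generalizing x y
  · exact this y x hxy.symm hfxy.symm (lt_of_le_of_ne (not_lt.1 hlt) hxy.symm)
  obtain ⟨s, hs⟩ := x
  obtain ⟨t, ht⟩ := y
  have hst : s < t := hlt
  have hfst : f s = f t := hfxy
  obtain ⟨b, rfl⟩ := Nat.exists_eq_add_of_lt hst
  obtain ⟨c, rfl⟩ := Nat.exists_eq_add_of_le (Nat.le_of_lt_succ ht)
  refine ⟨s + c, by omega, ?_⟩
  rw [hf, Finset.prod_range_add, show s + b + 1 = s + (b + 1) from rfl, Finset.prod_range_add]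
  have h1 := prod_le_maxPow (A := A) f 0 s
  have h3 := prod_le_maxPow (A := A) f (s + b + 1) c
  simp only [zero_add] at h1
  rw [← hfst] at h3
  -- The pieces before and after the repeated node join up to a walk of length `s + c`; the cycle
  -- cut out contributes a factor at most 1.
  refine le_trans ?_ (maxPow_mul_le A s c _ (f s) _)
  refine mul_le_mul' ?_ h3
  refine (mul_le_of_le_one_right' ?_).trans h1
  exact Finset.prod_le_one' fun _ _ => hA _ _

theorem bddAbove_maxPow (hA : ∀ i j, A i j ≤ 1) (i j : ι) :
    BddAbove (Set.range fun k => maxPow A k i j) :=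
  ⟨1, by rintro _ ⟨k, rfl⟩; exact maxPow_le_one hA k i j⟩

theorem maxPow_le_kleeneStar (hA : ∀ i j, A i j ≤ 1) (k : ℕ) (i j : ι) :
    maxPow A k i j ≤ kleeneStar A i j :=
  le_ciSup (bddAbove_maxPow hA i j) k

/-- Repeatedly cutting out cycles leaves only exponents below the order of the matrix, so the
supremum is a maximum over finitely many. -/
theorem exists_kleeneStar_eq (hA : ∀ i j, A i j ≤ 1) (i j : ι) :
    ∃ k, kleeneStar A i j = maxPow A k i j := by
  have hred : ∀ k, ∃ k' < Fintype.card ι, maxPow A k i j ≤ maxPow A k' i j := by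
    intro k
    induction k using Nat.strong_induction_on with
    | _ k ih =>
      by_cases hk : k < Fintype.card ι
      · exact ⟨k, hk, le_rfl⟩
      · obtain ⟨k', hk', hle⟩ := exists_lt_maxPow_le hA (not_lt.1 hk) i j
        obtain ⟨k'', hk'', hle'⟩ := ih k' hk'
        exact ⟨k'', hk'', hle.trans hle'⟩
  obtain ⟨m, -, hm⟩ := Finset.exists_max_image (Finset.range (Fintype.card ι))
    (fun k => maxPow A k i j) ⟨0, Finset.mem_range.2 (Fintype.card_pos_iff.2 ⟨i⟩)⟩
  refine ⟨m, le_antisymm (ciSup_le fun k => ?_) (maxPow_le_kleeneStar hA m i j)⟩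
  obtain ⟨k', hk', hle⟩ := hred k
  exact hle.trans (hm k' (Finset.mem_range.2 hk'))

theorem one_le_kleeneStar_self (hA : ∀ i j, A i j ≤ 1) (i : ι) : 1 ≤ kleeneStar A i i := by
  simpa [maxPow_zero_self] using maxPow_le_kleeneStar hA 0 i i

theorem kleeneStar_mul_le (hA : ∀ i j, A i j ≤ 1) (i k j : ι) :
    kleeneStar A i k * kleeneStar A k j ≤ kleeneStar A i j := by
  obtain ⟨a, ha⟩ := exists_kleeneStar_eq hA i k
  obtain ⟨b, hb⟩ := exists_kleeneStar_eq hA k j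
  rw [ha, hb]
  exact (maxPow_mul_le A a b i k j).trans (maxPow_le_kleeneStar hA _ i j)

end Powers

/-! ### Walks of prescribed length -/

section Walks

variable {V : Type*}

/-- There is a path with `k` edges from `u` to `v`. -/
def Walk (G : Digraph V) (k : ℕ) (u v : V) : Prop :=
  ∃ w : Fin (k + 1) → V, IsPath G w ∧ w 0 = u ∧ w (Fin.last k) = v

theorem IsPath.walk_of_le {G : Digraph V} {k : ℕ} {w : Fin (k + 1) → V} (hw : IsPath G w)
    (s d : ℕ) (h : s + d ≤ k) :
    Walk G d (w ⟨s, by omega⟩) (w ⟨s + d, by omega⟩) :=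
  ⟨fun t => w ⟨s + t, by omega⟩, fun t => hw ⟨s + t, by omega⟩, rfl, rfl⟩

theorem walk_zero (G : Digraph V) (u : V) : Walk G 0 u u :=
  ⟨fun _ => u, fun t => t.elim0, rfl, rfl⟩

theorem Walk.cons {G : Digraph V} {k : ℕ} {u v x : V} (h : G.Adj u v) (hw : Walk G k v x) :
    Walk G (k + 1) u x := by
  obtain ⟨w, hp, rfl, rfl⟩ := hw
  refine ⟨Fin.cons u w, fun t => ?_, rfl, by simp [← Fin.succ_last]⟩
  refine Fin.cases ?_ (fun t => ?_) t
  · simpa using h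
  · simpa [← Fin.succ_castSucc] using hp t

theorem Walk.eq_of_zero {G : Digraph V} {u v : V} (h : Walk G 0 u v) : u = v := by
  obtain ⟨w, -, rfl, rfl⟩ := h
  rfl

theorem Walk.exists_adj {G : Digraph V} {k : ℕ} {u v : V} (h : Walk G (k + 1) u v) :
    ∃ x, G.Adj u x ∧ Walk G k x v := by
  obtain ⟨w, hp, rfl, rfl⟩ := h
  exact ⟨w 1, hp 0, fun t => w t.succ, fun t => hp t.succ, rfl, rfl⟩

theorem Walk.trans {G : Digraph V} {a b : ℕ} {u v x : V} (h₁ : Walk G a u v) (h₂ : Walk G b v x) :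
    Walk G (a + b) u x := by
  induction a generalizing u with
  | zero => rw [h₁.eq_of_zero, zero_add]; exact h₂
  | succ a ih =>
    obtain ⟨y, hy, hw⟩ := h₁.exists_adj
    rw [add_right_comm]
    exact (ih hw).cons hy

theorem Walk.mul {G : Digraph V} {k : ℕ} {u : V} (h : Walk G k u u) (m : ℕ) :
    Walk G (k * m) u u := by
  induction m with
  | zero => exact walk_zero G u
  | succ m ih => exact ih.trans h

end Walks

/-! ### Cyclicity and lengths of closed walks -/

section Cyclicity

variable {V : Type*} {G : Digraph V}

theorem walk_of_adj {k : ℕ} (f : ℕ → V) (h : ∀ t < k, G.Adj (f t) (f (t + 1))) :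
    Walk G k (f 0) (f k) :=
  ⟨fun t => f t, fun t => h t t.2, rfl, rfl⟩

theorem IsPath.exists_walk_of_closed {k : ℕ} {w : Fin (k + 1) → V} (hw : IsPath G w)
    (hc : w 0 = w (Fin.last k)) (s t : Fin (k + 1)) : ∃ d, Walk G d (w s) (w t) := by
  have h₁ := hw.walk_of_le s (k - s) (by omega)
  have h₂ := hw.walk_of_le 0 t (by omega)
  have e₁ : (⟨s + (k - s), by omega⟩ : Fin (k + 1)) = Fin.last k :=
    Fin.ext (by simp only [Fin.val_last]; omega)
  have e₂ : (⟨0 + t, by omega⟩ : Fin (k + 1)) = t := Fin.ext (by simp)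
  rw [e₁, ← hc] at h₁
  rw [e₂] at h₂
  exact ⟨_, h₁.trans h₂⟩

theorem IsPath.walk_self_of_closed {k : ℕ} {w : Fin (k + 1) → V} (hw : IsPath G w)
    (hc : w 0 = w (Fin.last k)) (t : Fin (k + 1)) : Walk G k (w t) (w t) := by
  have h₁ := hw.walk_of_le t (k - t) (by omega)
  have h₂ := hw.walk_of_le 0 t (by omega)
  have e₁ : (⟨t + (k - t), by omega⟩ : Fin (k + 1)) = Fin.last k :=
    Fin.ext (by simp only [Fin.val_last]; omega)
  have e₂ : (⟨0 + t, by omega⟩ : Fin (k + 1)) = t := Fin.ext (by simp)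
  rw [e₁, ← hc] at h₁
  rw [e₂] at h₂
  have h := h₁.trans h₂
  rwa [Nat.sub_add_cancel (Nat.le_of_lt_succ t.2)] at h

theorem setGcd_walk_pos {v : V} {k : ℕ} (hk : 0 < k) (hw : Walk G k v v) :
    0 < Nat.setGcd {k | Walk G k v v} := by
  refine Nat.pos_of_ne_zero fun h => ?_
  exact hk.ne' (Nat.setGcd_eq_zero_iff.1 h hw)

/-- A cycle of length `m` elsewhere in the component is reached from `v` by a round trip of length
`p + q`. Both `p + q` and `p + q + m` are then closed walk lengths at `v`, so their gcd divides `m`.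
-/
theorem componentCyclicity_eq_setGcd {v : V} {k : ℕ} (hk : 0 < k) (hw : Walk G k v v) :
    componentCyclicity G v = Nat.setGcd {k | Walk G k v v} := by
  refine IsGreatest.csSup_eq ⟨?_, ?_⟩
  · intro m w hcyc hcomp
    obtain ⟨⟨p, hp⟩, ⟨q, hq⟩⟩ := hcomp 0
    have hp' : Walk G p v (w 0) := hp
    have hq' : Walk G q (w 0) v := hq
    have h₁ := Nat.setGcd_dvd_of_mem (s := {k | Walk G k v v}) (hp'.trans hq')
    have h₂ := Nat.setGcd_dvd_of_mem (s := {k | Walk G k v v})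
      ((hp'.trans hq').trans ((hp'.trans (hcyc.2.1.walk_self_of_closed hcyc.2.2 0)).trans hq'))
    have h₃ := (Nat.dvd_add_right h₁).1 h₂
    rw [add_right_comm] at h₃
    exact (Nat.dvd_add_right h₁).1 h₃
  · intro d hd
    refine Nat.le_of_dvd (setGcd_walk_pos hk hw) (Nat.dvd_setGcd_iff.2 fun m hm => ?_)
    rcases Nat.eq_zero_or_pos m with rfl | hm0
    · exact dvd_zero d
    obtain ⟨w, hp, h0, hl⟩ := hm
    have hc : w 0 = w (Fin.last m) := h0.trans hl.symm
    refine hd m w ⟨hm0, hp, hc⟩ fun t => ?_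
    rw [← h0]
    exact ⟨hp.exists_walk_of_closed hc 0 t, hp.exists_walk_of_closed hc t 0⟩

theorem componentCyclicity_dvd_cyclicity [Fintype V] (v : V) :
    componentCyclicity G v ∣ cyclicity G :=
  Finset.dvd_lcm (Finset.mem_univ v)

theorem cyclicity_pos [Fintype V] (hG : ∀ v, ∃ k, 0 < k ∧ Walk G k v v) : 0 < cyclicity G := by
  refine Nat.pos_of_ne_zero fun h => ?_
  obtain ⟨v, -, hv⟩ := Finset.lcm_eq_zero_iff.1 h
  obtain ⟨k, hk, hw⟩ := hG v
  have hv' : componentCyclicity G v = 0 := hv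
  rw [componentCyclicity_eq_setGcd hk hw] at hv'
  exact (setGcd_walk_pos hk hw).ne' hv'

/-- All large multiples of the cyclicity are lengths of closed walks at a given node. -/
theorem exists_forall_walk_mul_cyclicity [Fintype V] (hG : ∀ v, ∃ k, 0 < k ∧ Walk G k v v)
    (v : V) : ∃ t₀, ∀ t ≥ t₀, Walk G (t * cyclicity G) v v := by
  obtain ⟨k, hk, hw⟩ := hG v
  obtain ⟨N, hN⟩ := Nat.exists_mem_closure_of_ge {k | Walk G k v v}
  -- Closed walk lengths at `v` form a submonoid of `ℕ`, which contains all large multiples of its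
  -- gcd.
  let L : AddSubmonoid ℕ :=
    { carrier := {k | Walk G k v v}
      zero_mem' := walk_zero G v
      add_mem' := fun ha hb => Walk.trans ha hb }
  have hcl : AddSubmonoid.closure {k | Walk G k v v} ≤ L := AddSubmonoid.closure_le.2 le_rfl
  refine ⟨N, fun t ht => hcl (hN _ ?_ ?_)⟩
  · exact ht.trans (Nat.le_mul_of_pos_right t (cyclicity_pos hG))
  · rw [← componentCyclicity_eq_setGcd hk hw]
    exact (componentCyclicity_dvd_cyclicity v).mul_left t

theorem exists_walk_of_length (hG : ∀ v, ∃ k, 0 < k ∧ Walk G k v v) (l : ℕ) (u : V) :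
    ∃ v, Walk G l u v := by
  induction l generalizing u with
  | zero => exact ⟨u, walk_zero G u⟩
  | succ l ih =>
    obtain ⟨k, hk, hw⟩ := hG u
    obtain ⟨k, rfl⟩ := Nat.exists_eq_succ_of_ne_zero hk.ne'
    obtain ⟨x, hx, -⟩ := hw.exists_adj
    obtain ⟨v, hv⟩ := ih x
    exact ⟨v, hv.cons hx⟩

theorem Walk.exists_reverse (hG : ∀ u v, G.Adj u v → ∃ d, Walk G d v u) {p : ℕ} {u v : V}
    (h : Walk G p u v) : ∃ d, Walk G d v u := by
  induction p generalizing u with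
  | zero => exact ⟨0, h.eq_of_zero ▸ walk_zero G u⟩
  | succ p ih =>
    obtain ⟨x, hx, hw⟩ := h.exists_adj
    obtain ⟨a, ha⟩ := ih hw
    obtain ⟨b, hb⟩ := hG u x hx
    exact ⟨a + b, ha.trans hb⟩

/-- A walk can be closed up to one whose length is a multiple of a given number. -/
theorem Walk.exists_reverse_dvd (hG : ∀ u v, G.Adj u v → ∃ d, Walk G d v u) {p : ℕ} {u v : V}
    (h : Walk G p u v) {c : ℕ} (hc : 0 < c) : ∃ q, c ∣ p + q ∧ Walk G q v u := by
  obtain ⟨d, hd⟩ := h.exists_reverse hG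
  -- Return once, then run the closed walk `c - 1` more times: the total is `c * (p + d)`.
  refine ⟨d + (p + d) * (c - 1), ?_, hd.trans ((h.trans hd).mul _)⟩
  obtain ⟨c, rfl⟩ := Nat.exists_eq_succ_of_ne_zero hc.ne'
  exact ⟨p + d, by simp only [Nat.succ_eq_add_one, Nat.add_sub_cancel]; ring⟩

end Cyclicity

/-! ### Critical nodes as closed walks of weight 1 -/

section Critical

variable {ι : Type*} [Fintype ι] [DecidableEq ι] {A : Matrix ι ι ℝ≥0}

/-- The digraph of the entries equal to `1`. -/
def oneDigraph (A : Matrix ι ι ℝ≥0) : Digraph ι :=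
  ⟨fun i j => A i j = 1⟩

theorem eq_one_of_prod_eq_one {α : Type*} {s : Finset α} {f : α → ℝ≥0} (hf : ∀ i ∈ s, f i ≤ 1)
    (h : ∏ i ∈ s, f i = 1) {i : α} (hi : i ∈ s) : f i = 1 := by
  classical
  refine le_antisymm (hf i hi) ?_
  rw [← h, ← Finset.mul_prod_erase s f hi]
  exact mul_le_of_le_one_right' (Finset.prod_le_one' fun j hj => hf j (Finset.mem_of_mem_erase hj))

theorem walk_digraph_of_maxPow_ne_zero {k : ℕ} {i j : ι} (h : maxPow A k i j ≠ 0) :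
    Walk (digraph A) k i j := by
  obtain ⟨f, rfl, rfl, hf⟩ := exists_prod_eq_maxPow h
  rw [hf, Finset.prod_ne_zero_iff] at h
  exact walk_of_adj f fun t ht => h t (Finset.mem_range.2 ht)

theorem maxPow_ne_zero_of_walk {k : ℕ} {i j : ι} (h : Walk (digraph A) k i j) :
    maxPow A k i j ≠ 0 := by
  induction k generalizing i with
  | zero => rw [h.eq_of_zero, maxPow_zero_self]; exact one_ne_zero
  | succ k ih =>
    obtain ⟨x, hx, hw⟩ := h.exists_adj
    rw [add_comm]
    exact maxPow_mul_ne_zero A (k := x) (by rw [maxPow_one]; exact hx) (ih hw)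

/-- A product of factors at most 1 equals 1 only if every factor does. -/
theorem maxPow_eq_one_iff (hA : ∀ i j, A i j ≤ 1) {k : ℕ} {i j : ι} :
    maxPow A k i j = 1 ↔ Walk (oneDigraph A) k i j := by
  constructor
  · intro h
    obtain ⟨f, rfl, rfl, hf⟩ := exists_prod_eq_maxPow (h ▸ one_ne_zero)
    rw [h] at hf
    exact walk_of_adj f fun t ht =>
      eq_one_of_prod_eq_one (fun t _ => hA _ _) hf.symm (Finset.mem_range.2 ht)
  · intro h
    refine le_antisymm (maxPow_le_one hA k i j) ?_
    induction k generalizing i with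
    | zero => rw [h.eq_of_zero, maxPow_zero_self]
    | succ k ih =>
      obtain ⟨x, hx, hw⟩ := h.exists_adj
      have hx' : A i x = 1 := hx
      rw [add_comm]
      refine le_trans ?_ (maxPow_mul_le A 1 k i x j)
      rw [maxPow_one, hx', one_mul]
      exact ih hw

theorem IsCriticalCycle.isPath_oneDigraph (hA : ∀ i j, A i j ≤ 1) (he : eigen A = 1) {k : ℕ}
    {w : Fin (k + 1) → ι} (hw : IsCriticalCycle A w) : IsPath (oneDigraph A) w := by
  have hk : (1 / (k : ℝ)) ≠ 0 := by
    have := hw.1.1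
    positivity
  have h1 : pathWeight A w = 1 := by
    have h := hw.2
    rw [he, ← NNReal.one_rpow (1 / (k : ℝ))] at h
    exact NNReal.rpow_left_injective hk h
  exact fun t => eq_one_of_prod_eq_one (fun t _ => hA _ _) h1 (Finset.mem_univ t)

theorem isCriticalCycle_of_isPath_oneDigraph (he : eigen A = 1) {k : ℕ} (hk : 0 < k)
    {w : Fin (k + 1) → ι} (hw : IsPath (oneDigraph A) w) (hc : w 0 = w (Fin.last k)) :
    IsCriticalCycle A w := by
  have hw' : ∀ t : Fin k, A (w t.castSucc) (w t.succ) = 1 := hw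
  refine ⟨⟨hk, fun t => ?_, hc⟩, ?_⟩
  · change A _ _ ≠ 0
    rw [hw']
    exact one_ne_zero
  · rw [pathWeight, Finset.prod_congr rfl fun t _ => hw' t, he]
    simp

theorem isCriticalNode_iff (hA : ∀ i j, A i j ≤ 1) (he : eigen A = 1) {i : ι} :
    IsCriticalNode A i ↔ ∃ k, 0 < k ∧ maxPow A k i i = 1 := by
  constructor
  · rintro ⟨k, w, hw, t, rfl⟩
    exact ⟨k, hw.1.1, (maxPow_eq_one_iff hA).2
      ((hw.isPath_oneDigraph hA he).walk_self_of_closed hw.1.2.2 t)⟩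
  · rintro ⟨k, hk, h⟩
    obtain ⟨w, hp, h0, hl⟩ := (maxPow_eq_one_iff hA).1 h
    exact ⟨k, w, isCriticalCycle_of_isPath_oneDigraph he hk hp (h0.trans hl.symm), 0, h0⟩

theorem mem_criticalNodes {i : ι} : i ∈ criticalNodes A ↔ IsCriticalNode A i := by
  simp [criticalNodes]

theorem IsCriticalCycle.exists_lift {k : ℕ} {w : Fin (k + 1) → ι} (hw : IsCriticalCycle A w) :
    ∃ w' : Fin (k + 1) → criticalNodes A, IsPath (criticalDigraph A) w' ∧
      w' 0 = w' (Fin.last k) ∧ ∀ t, (w' t : ι) = w t :=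
  ⟨fun t => ⟨w t, mem_criticalNodes.2 ⟨k, w, hw, t, rfl⟩⟩, fun t => ⟨k, w, hw, t, rfl, rfl⟩,
    Subtype.ext hw.1.2.2, fun _ => rfl⟩

theorem exists_walk_criticalDigraph_self (v : criticalNodes A) :
    ∃ k, 0 < k ∧ Walk (criticalDigraph A) k v v := by
  obtain ⟨k, w, hw, t, ht⟩ := mem_criticalNodes.1 v.2
  obtain ⟨w', hp, hc, hval⟩ := hw.exists_lift
  have : w' t = v := Subtype.ext ((hval t).trans ht)
  exact ⟨k, hw.1.1, this ▸ hp.walk_self_of_closed hc t⟩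

theorem exists_walk_criticalDigraph_reverse (u v : criticalNodes A)
    (h : (criticalDigraph A).Adj u v) : ∃ d, Walk (criticalDigraph A) d v u := by
  obtain ⟨k, w, hw, t, hu, hv⟩ := h
  obtain ⟨w', hp, hc, hval⟩ := hw.exists_lift
  have hu' : w' t.castSucc = u := Subtype.ext ((hval _).trans hu)
  have hv' : w' t.succ = v := Subtype.ext ((hval _).trans hv)
  rw [← hu', ← hv']
  exact hp.exists_walk_of_closed hc _ _

theorem gam_pos : 0 < gam A :=
  cyclicity_pos exists_walk_criticalDigraph_self

theorem maxPow_eq_one_of_walk_criticalDigraph (hvis : Visualized A) {k : ℕ}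
    {u v : criticalNodes A} (h : Walk (criticalDigraph A) k u v) : maxPow A k u v = 1 := by
  obtain ⟨w, hp, rfl, rfl⟩ := h
  exact (maxPow_eq_one_iff hvis.1).2 ⟨fun t => w t, fun t => hvis.2 _ _ (hp t), rfl, rfl⟩

theorem exists_forall_maxPow_mul_gam_eq_one (hvis : Visualized A) (v : criticalNodes A) :
    ∃ t₀, ∀ t ≥ t₀, maxPow A (t * gam A) v v = 1 := by
  obtain ⟨t₀, h⟩ := exists_forall_walk_mul_cyclicity (G := criticalDigraph A)
    exists_walk_criticalDigraph_self v
  exact ⟨t₀, fun t ht => maxPow_eq_one_of_walk_criticalDigraph hvis (h t ht)⟩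

theorem matS_apply_eq_one {u v : criticalNodes A} (h : (criticalDigraph A).Adj u v) :
    matS A u v = 1 := by
  have h' : IsCriticalEdge A u v := h
  simp [matS, criticalMatrix, h']

theorem adj_of_matS_apply_ne_zero {u v : criticalNodes A} (h : matS A u v ≠ 0) :
    (criticalDigraph A).Adj u v := by
  by_contra h'
  have h'' : ¬ IsCriticalEdge A u v := h'
  exact h (by simp [matS, criticalMatrix, h''])

theorem matS_le_one (u v : criticalNodes A) : matS A u v ≤ 1 := by
  by_cases h : matS A u v = 0
  · simp [h]
  · rw [matS_apply_eq_one (adj_of_matS_apply_ne_zero h)]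

theorem maxPow_matS_eq_one {l : ℕ} {u v : criticalNodes A} (h : Walk (criticalDigraph A) l u v) :
    maxPow (matS A) l u v = 1 := by
  obtain ⟨w, hp, rfl, rfl⟩ := h
  exact (maxPow_eq_one_iff matS_le_one).2 ⟨w, fun t => matS_apply_eq_one (hp t), rfl, rfl⟩

theorem walk_of_maxPow_matS_ne_zero {l : ℕ} {u v : criticalNodes A}
    (h : maxPow (matS A) l u v ≠ 0) : Walk (criticalDigraph A) l u v := by
  obtain ⟨w, hp, rfl, rfl⟩ := walk_digraph_of_maxPow_ne_zero h
  exact ⟨w, fun t => adj_of_matS_apply_ne_zero (hp t), rfl, rfl⟩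

theorem eigen_le_one (hA : ∀ i j, A i j ≤ 1) : eigen A ≤ 1 :=
  Finset.sup_le fun k _ => NNReal.rpow_le_one
    (Finset.sup_le fun i _ => maxPow_le_one hA k i i) (by positivity)

theorem one_le_eigen {k : ℕ} (hk : k ∈ Finset.Icc 1 (Fintype.card ι)) {i : ι}
    (h : maxPow A k i i = 1) : 1 ≤ eigen A := by
  refine le_trans ?_ (Finset.le_sup hk)
  refine NNReal.one_le_rpow ?_ (by positivity)
  rw [← h]
  exact Finset.le_sup (f := fun i => maxPow A k i i) (Finset.mem_univ i)

theorem exists_maxPow_self_eq_one (he : eigen A = 1) :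
    ∃ k ∈ Finset.Icc 1 (Fintype.card ι), ∃ i, maxPow A k i i = 1 := by
  have hne : (Finset.Icc 1 (Fintype.card ι)).Nonempty := by
    by_contra h
    rw [Finset.not_nonempty_iff_eq_empty] at h
    simp [eigen, h] at he
  obtain ⟨k, hk, hk'⟩ := Finset.exists_mem_eq_sup _ hne
    fun k => maxTrace (maxPow A k) ^ (1 / (k : ℝ))
  have hpos : 1 ≤ k := (Finset.mem_Icc.1 hk).1
  have hn : Nonempty ι := Fintype.card_pos_iff.1 (hpos.trans (Finset.mem_Icc.1 hk).2)
  obtain ⟨i, -, hi⟩ := Finset.exists_mem_eq_sup (Finset.univ : Finset ι) Finset.univ_nonempty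
    fun i => maxPow A k i i
  refine ⟨k, hk, i, ?_⟩
  have hk0 : (1 / (k : ℝ)) ≠ 0 := by positivity
  have h1 : maxTrace (maxPow A k) ^ (1 / (k : ℝ)) = 1 := hk'.symm.trans he
  rw [← NNReal.one_rpow (1 / (k : ℝ))] at h1
  exact hi.symm.trans (NNReal.rpow_left_injective hk0 h1)

theorem maxPow_self_mul_eq_one (hA : ∀ i j, A i j ≤ 1) {k : ℕ} {i : ι} (h : maxPow A k i i = 1)
    (m : ℕ) : maxPow A (k * m) i i = 1 := by
  refine le_antisymm (maxPow_le_one hA _ i i) ?_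
  simpa [h] using pow_maxPow_self_le A k m i

/-- A closed walk of weight 1 and length `k`, run `m` times, has length `m * k`. Hence the same `k`,
within the range allowed by `eigen`, serves for the power. -/
theorem eigen_maxPow (hA : ∀ i j, A i j ≤ 1) (he : eigen A = 1) (m : ℕ) :
    eigen (maxPow A m) = 1 := by
  obtain ⟨k, hk, i, hi⟩ := exists_maxPow_self_eq_one he
  refine le_antisymm (eigen_le_one (maxPow_le_one hA m)) (one_le_eigen hk (i := i) ?_)
  rw [maxPow_maxPow, mul_comm]
  exact maxPow_self_mul_eq_one hA hi m

theorem criticalNodes_maxPow (hA : ∀ i j, A i j ≤ 1) (he : eigen A = 1) {m : ℕ} (hm : 0 < m) :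
    criticalNodes (maxPow A m) = criticalNodes A := by
  ext i
  rw [mem_criticalNodes, mem_criticalNodes, isCriticalNode_iff hA he,
    isCriticalNode_iff (maxPow_le_one hA m) (eigen_maxPow hA he m)]
  constructor
  · rintro ⟨k, hk, h⟩
    exact ⟨m * k, Nat.mul_pos hm hk, by rwa [← maxPow_maxPow]⟩
  · rintro ⟨k, hk, h⟩
    refine ⟨k, hk, ?_⟩
    rw [maxPow_maxPow, mul_comm]
    exact maxPow_self_mul_eq_one hA h m

/-- The term `k = c` dominates: the star is submultiplicative along `i, k, c`, and its diagonal is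
at least 1. -/
theorem spectralProjector_apply_right (hA : ∀ i j, A i j ≤ 1) (i : ι) {c : ι}
    (hc : c ∈ criticalNodes A) : spectralProjector A i c = kleeneStar A i c := by
  refine le_antisymm (Finset.sup_le fun k _ => kleeneStar_mul_le hA i k c) ?_
  exact (le_mul_of_one_le_right' (one_le_kleeneStar_self hA c)).trans
    (Finset.le_sup (f := fun k => kleeneStar A i k * kleeneStar A k c) hc)

theorem spectralProjector_apply_left (hA : ∀ i j, A i j ≤ 1) {c : ι}
    (hc : c ∈ criticalNodes A) (j : ι) : spectralProjector A c j = kleeneStar A c j := by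
  refine le_antisymm (Finset.sup_le fun k _ => kleeneStar_mul_le hA c k j) ?_
  exact (le_mul_of_one_le_left' (one_le_kleeneStar_self hA c)).trans
    (Finset.le_sup (f := fun k => kleeneStar A c k * kleeneStar A k j) hc)

end Critical

/-! ### Comparison of the powers with the CSR product -/

section CSR

open Filter

variable {ι : Type*} [Fintype ι] [DecidableEq ι] {A : Matrix ι ι ℝ≥0}

open Classical in
/-- The matrix `A` with all rows and columns of critical nodes replaced by zero. -/
noncomputable def noncriticalPart (A : Matrix ι ι ℝ≥0) : Matrix ι ι ℝ≥0 :=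
  Matrix.of fun i j => if i ∈ criticalNodes A ∨ j ∈ criticalNodes A then 0 else A i j

theorem noncriticalPart_le (i j : ι) : noncriticalPart A i j ≤ A i j := by
  simp only [noncriticalPart, Matrix.of_apply]
  split_ifs <;> simp

theorem noncriticalPart_eq {i j : ι} (hi : i ∉ criticalNodes A) (hj : j ∉ criticalNodes A) :
    noncriticalPart A i j = A i j := by
  simp [noncriticalPart, hi, hj]

theorem noncriticalPart_eq_zero {i j : ι} (hi : i ∈ criticalNodes A) :
    noncriticalPart A i j = 0 := by
  simp [noncriticalPart, hi]

theorem maxPow_le_noncriticalPart_or (r : ℕ) (i j : ι) :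
    maxPow A r i j ≤ maxPow (noncriticalPart A) r i j ∨
      ∃ c ∈ criticalNodes A, ∃ a b, a + b = r ∧
        maxPow A r i j ≤ maxPow A a i c * maxPow A b c j := by
  induction r generalizing j with
  | zero => exact Or.inl le_rfl
  | succ r ih =>
    by_cases h0 : maxPow A (r + 1) i j = 0
    · exact Or.inl (by simp [h0])
    obtain ⟨k, hk⟩ := exists_maxMul_eq h0
    have hk' : maxPow A (r + 1) i j = maxPow A r i k * A k j := hk
    rcases ih k with h | ⟨c, hc, a, b, hab, h⟩
    · by_cases hj : j ∈ criticalNodes A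
      · exact Or.inr ⟨j, hj, r + 1, 0, rfl, by rw [maxPow_zero_self, mul_one]⟩
      by_cases hkc : k ∈ criticalNodes A
      · exact Or.inr ⟨k, hkc, r, 1, rfl, by rw [hk', maxPow_one]⟩
      · refine Or.inl ?_
        rw [hk', ← noncriticalPart_eq hkc hj]
        exact (mul_le_mul_left h _).trans (mul_le_maxMul _ _ _ _ _)
    · refine Or.inr ⟨c, hc, a, b + 1, by omega, ?_⟩
      rw [hk']
      refine (mul_le_mul_left h _).trans ?_
      rw [mul_assoc]
      exact mul_le_mul_right (mul_le_maxMul _ _ _ _ _) _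

/-- A walk of ones this long repeats a node. That node is critical, but then its row has been set to
zero. -/
theorem maxPow_noncriticalPart_lt_one (hA : ∀ i j, A i j ≤ 1) (he : eigen A = 1) (i j : ι) :
    maxPow (noncriticalPart A) (Fintype.card ι) i j < 1 := by
  have hA' : ∀ i j, noncriticalPart A i j ≤ 1 := fun i j => (noncriticalPart_le i j).trans (hA i j)
  refine lt_of_le_of_ne (maxPow_le_one hA' _ i j) fun h => ?_
  obtain ⟨w, hp, -, -⟩ := (maxPow_eq_one_iff hA').1 h
  obtain ⟨x, y, hxy, hw⟩ := Fintype.exists_ne_map_eq_of_card_lt w (by simp)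
  wlog hlt : x < y generalizing x y
  · exact this y x hxy.symm hw.symm (lt_of_le_of_ne (not_lt.1 hlt) hxy.symm)
  have hlt' : x.1 < y.1 := hlt
  have hwalk := hp.walk_of_le x (y - x) (by omega)
  have hy : (⟨x + (y - x), by omega⟩ : Fin (Fintype.card ι + 1)) = y :=
    Fin.ext (by simp only; omega)
  rw [hy] at hwalk
  have hone : ∀ i j, (oneDigraph (noncriticalPart A)).Adj i j → (oneDigraph A).Adj i j := by
    intro i j hij
    have hij' : noncriticalPart A i j = 1 := hij
    exact le_antisymm (hA i j) (hij' ▸ noncriticalPart_le i j)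
  have hcrit : w x ∈ criticalNodes A := by
    refine mem_criticalNodes.2 ((isCriticalNode_iff hA he).2 ⟨y - x, by omega, ?_⟩)
    obtain ⟨v, hv, h0, hl⟩ := hwalk
    exact (maxPow_eq_one_iff hA).2 ⟨v, fun t => hone _ _ (hv t), h0, hl.trans hw.symm⟩
  have hedge : noncriticalPart A (w x) (w (Fin.succ ⟨x, by omega⟩)) = 1 := hp ⟨x, by omega⟩
  rw [noncriticalPart_eq_zero hcrit] at hedge
  exact zero_ne_one hedge

/-- Walks that avoid all critical nodes have asymptotically negligible weights. -/
theorem eventually_maxPow_noncriticalPart_lt (hA : ∀ i j, A i j ≤ 1) (he : eigen A = 1)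
    {ε : ℝ≥0} (hε : 0 < ε) :
    ∀ᶠ r in atTop, ∀ i j, maxPow (noncriticalPart A) r i j < ε := by
  have hA' : ∀ i j, noncriticalPart A i j ≤ 1 := fun i j => (noncriticalPart_le i j).trans (hA i j)
  set N := Fintype.card ι
  obtain ⟨ρ, hρ, hle⟩ : ∃ ρ < (1 : ℝ≥0), ∀ i j, maxPow (noncriticalPart A) N i j ≤ ρ := by
    refine ⟨Finset.univ.sup fun p : ι × ι => maxPow (noncriticalPart A) N p.1 p.2,
      (Finset.sup_lt_iff zero_lt_one).2 fun p _ => maxPow_noncriticalPart_lt_one hA he p.1 p.2,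
      fun i j => ?_⟩
    exact Finset.le_sup (f := fun p : ι × ι => maxPow (noncriticalPart A) N p.1 p.2)
      (Finset.mem_univ (i, j))
  have hpow : ∀ m i j, maxPow (noncriticalPart A) (N * m) i j ≤ ρ ^ m := by
    intro m
    induction m with
    | zero => exact fun i j => maxPow_le_one hA' _ i j
    | succ m ih =>
      intro i j
      rw [Nat.mul_succ, maxPow_add, pow_succ]
      exact maxMul_le fun k => mul_le_mul' (ih i k) (hle k j)
  obtain ⟨m, hm⟩ := exists_pow_lt_of_lt_one hε hρ
  filter_upwards [eventually_ge_atTop (N * m)] with r hr i j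
  obtain ⟨d, rfl⟩ := Nat.exists_eq_add_of_le hr
  refine lt_of_le_of_lt ?_ hm
  rw [maxPow_add]
  exact maxMul_le fun k =>
    (mul_le_of_le_one_right' (maxPow_le_one hA' d k j)).trans (hpow m i k)

theorem matC_apply (hA : ∀ i j, A i j ≤ 1) (he : eigen A = 1) (i : ι) (c : criticalNodes A) :
    matC A i c = kleeneStar (maxPow A (gam A)) i c :=
  spectralProjector_apply_right (maxPow_le_one hA _) i
    (by rw [criticalNodes_maxPow hA he gam_pos]; exact c.2)

theorem matR_apply (hA : ∀ i j, A i j ≤ 1) (he : eigen A = 1) (c : criticalNodes A) (j : ι) :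
    matR A c j = kleeneStar (maxPow A (gam A)) c j :=
  spectralProjector_apply_left (maxPow_le_one hA _)
    (by rw [criticalNodes_maxPow hA he gam_pos]; exact c.2) j

/-- The product `C ⊗ S ^ l ⊗ R`. -/
noncomputable def csr (A : Matrix ι ι ℝ≥0) (l : ℕ) : Matrix ι ι ℝ≥0 :=
  maxMul (maxMul (matC A) (maxPow (matS A) l)) (matR A)

theorem csr_zero (hA : ∀ i j, A i j ≤ 1) (he : eigen A = 1) :
    csr A 0 = spectralProjector (maxPow A (gam A)) := by
  ext i j
  congr 1
  have h : csr A 0 = maxMul (matC A) (matR A) := by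
    rw [csr, maxPow, maxMul_one]
  rw [h, spectralProjector, Matrix.of_apply, criticalNodes_maxPow hA he gam_pos]
  refine le_antisymm (maxMul_le fun c => ?_) (Finset.sup_le fun c hc => ?_)
  · rw [matC_apply hA he, matR_apply hA he]
    exact Finset.le_sup (f := fun k => kleeneStar (maxPow A (gam A)) i k *
      kleeneStar (maxPow A (gam A)) k j) c.2
  · have h := mul_le_maxMul (matC A) (matR A) i ⟨c, hc⟩ j
    rwa [matC_apply hA he, matR_apply hA he] at h

theorem eventually_csr_le (hvis : Visualized A) (he : eigen A = 1) (l : ℕ) (i j : ι) :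
    ∀ᶠ r in atTop, r ≡ l [MOD gam A] → csr A l i j ≤ maxPow A r i j := by
  by_cases h : csr A l i j = 0
  · simp [h]
  have hB := maxPow_le_one hvis.1 (gam A)
  obtain ⟨d, hd⟩ := exists_maxMul_eq h
  have hd' : csr A l i j = maxMul (matC A) (maxPow (matS A) l) i d * matR A d j := hd
  obtain ⟨c, hc⟩ := exists_maxMul_eq (A := matC A) (B := maxPow (matS A) l) (i := i) (j := d)
    fun h0 => h (by rw [hd', h0, zero_mul])
  have hS : Walk (criticalDigraph A) l c d := walk_of_maxPow_matS_ne_zero fun h0 =>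
    h (by rw [hd', hc, h0, mul_zero, zero_mul])
  rw [maxPow_matS_eq_one hS, mul_one] at hc
  obtain ⟨a, ha⟩ := exists_kleeneStar_eq hB i c
  obtain ⟨b, hb⟩ := exists_kleeneStar_eq hB d j
  rw [hc, matC_apply hvis.1 he, matR_apply hvis.1 he, ha, hb, maxPow_maxPow, maxPow_maxPow] at hd'
  obtain ⟨t₀, ht₀⟩ := exists_forall_maxPow_mul_gam_eq_one hvis c
  -- Writing `r = l + γ(a + b + t)`, this threshold leaves `t ≥ t₀`, enough for a closed walk of
  -- weight 1 and length `tγ` at `c`.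
  filter_upwards [eventually_ge_atTop (l + gam A * (a + b + t₀))] with r hr hmod
  obtain ⟨q, hq⟩ := (Nat.modEq_iff_dvd' (by omega)).1 hmod.symm
  have hq' : a + b + t₀ ≤ q := by
    rw [← Nat.mul_le_mul_left_iff (gam_pos (A := A)), ← hq]
    omega
  obtain ⟨t, rfl⟩ : ∃ t, q = a + b + t := Nat.exists_eq_add_of_le (by omega)
  have hr' : r = gam A * a + (t * gam A + (l + gam A * b)) := by
    rw [← Nat.add_sub_of_le (show l ≤ r by omega), hq]
    ring
  rw [hr', hd']
  refine le_trans ?_ (maxPow_mul_le A _ _ i c j)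
  refine mul_le_mul_right ?_ _
  refine le_trans ?_ (maxPow_mul_le A _ _ c c j)
  rw [ht₀ t (by omega), one_mul]
  refine le_trans ?_ (maxPow_mul_le A _ _ c d j)
  rw [maxPow_eq_one_of_walk_criticalDigraph hvis hS, one_mul]

/-- Walks through critical nodes are dominated by the CSR product. -/
theorem maxPow_mul_le_csr (hvis : Visualized A) (he : eigen A = 1) {a b l : ℕ}
    (h : a + b ≡ l [MOD gam A]) (i j : ι) (c : criticalNodes A) :
    maxPow A a i c * maxPow A b c j ≤ csr A l i j := by
  have hB := maxPow_le_one hvis.1 (gam A)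
  have hγ : 0 < gam A := gam_pos
  have hstar : ∀ k, gam A ∣ k → ∀ u v, maxPow A k u v ≤ kleeneStar (maxPow A (gam A)) u v := by
    rintro _ ⟨k, rfl⟩ u v
    rw [← maxPow_maxPow]
    exact maxPow_le_kleeneStar hB k u v
  -- The critical closed walk from `c` to `d` to `e` and back, of lengths `s`, `l`, `q`, has total
  -- length divisible by `γ`. As `γ ∣ a + s` and `a + b ≡ l`, also `γ ∣ q + b`.
  obtain ⟨s, hs⟩ : ∃ s, a + s = gam A * a :=
    (Nat.exists_eq_add_of_le (Nat.le_mul_of_pos_left a hγ)).imp fun _ h => h.symm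
  obtain ⟨d, hd⟩ := exists_walk_of_length exists_walk_criticalDigraph_self s c
  obtain ⟨e, he'⟩ := exists_walk_of_length exists_walk_criticalDigraph_self l d
  obtain ⟨q, hq, hq'⟩ := (hd.trans he').exists_reverse_dvd exists_walk_criticalDigraph_reverse hγ
  have hqb : gam A ∣ q + b := by
    have h1 : s + (a + b) + q ≡ s + l + q [MOD gam A] := (h.add_left s).add_right q
    have h2 : gam A ∣ s + (a + b) + q := (h1.dvd_iff dvd_rfl).2 hq
    have h3 : s + (a + b) + q = gam A * a + (q + b) := by rw [← hs]; ring
    rw [h3] at h2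
    exact (Nat.dvd_add_right (dvd_mul_right _ _)).1 h2
  have hC : maxPow A a i c ≤ matC A i d := by
    rw [matC_apply hvis.1 he]
    refine le_trans ?_ (hstar (a + s) ⟨a, hs⟩ i d)
    refine le_trans ?_ (maxPow_mul_le A a s i c d)
    rw [maxPow_eq_one_of_walk_criticalDigraph hvis hd, mul_one]
  have hR : maxPow A b c j ≤ matR A e j := by
    rw [matR_apply hvis.1 he]
    refine le_trans ?_ (hstar (q + b) hqb e j)
    refine le_trans ?_ (maxPow_mul_le A q b e c j)
    rw [maxPow_eq_one_of_walk_criticalDigraph hvis hq', one_mul]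
  refine (mul_le_mul' hC hR).trans (le_trans ?_ (mul_le_maxMul _ _ i e j))
  refine mul_le_mul_left ?_ _
  have h := mul_le_maxMul (matC A) (maxPow (matS A) l) i d e
  rwa [maxPow_matS_eq_one he', mul_one] at h

theorem criticalNodes_nonempty (hA : ∀ i j, A i j ≤ 1) (he : eigen A = 1) :
    (criticalNodes A).Nonempty := by
  obtain ⟨k, hk, i, hi⟩ := exists_maxPow_self_eq_one he
  exact ⟨i, mem_criticalNodes.2 ((isCriticalNode_iff hA he).2 ⟨k, (Finset.mem_Icc.1 hk).1, hi⟩)⟩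

/-- A walk from `i` to `j` can first make `γ` round trips to a critical node, which preserves its
length mod `γ`; `maxPow_mul_le_csr` then applies. -/
theorem csr_ne_zero (hirr : Irred A) (hvis : Visualized A) (he : eigen A = 1) {r l : ℕ}
    (h : r ≡ l [MOD gam A]) {i j : ι} (hr : maxPow A r i j ≠ 0) : csr A l i j ≠ 0 := by
  obtain ⟨c, hc⟩ := criticalNodes_nonempty hvis.1 he
  obtain ⟨p, hp⟩ := hirr i c
  obtain ⟨q, hq⟩ := hirr c i
  have hp' := maxPow_ne_zero_of_walk (A := A) hp
  have hq' := maxPow_ne_zero_of_walk (A := A) hq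
  have hloop := maxPow_self_mul_ne_zero A (maxPow_mul_ne_zero A hp' hq') (gam A - 1)
  have htail := maxPow_mul_ne_zero A hq' (maxPow_mul_ne_zero A hloop hr)
  have hmod : p + (q + ((p + q) * (gam A - 1) + r)) ≡ l [MOD gam A] := by
    obtain ⟨g, hg⟩ := Nat.exists_eq_succ_of_ne_zero (gam_pos (A := A)).ne'
    have : p + (q + ((p + q) * (gam A - 1) + r)) = gam A * (p + q) + r := by
      simp only [hg, Nat.succ_eq_add_one, Nat.add_sub_cancel]
      ring
    rw [this]
    exact (Nat.modEq_iff_dvd.2 ⟨-(p + q), by push_cast; ring⟩ : _ ≡ r [MOD gam A]).trans h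
  exact ((pos_iff_ne_zero.2 (mul_ne_zero hp' htail)).trans_le
    (maxPow_mul_le_csr hvis he hmod i j ⟨c, hc⟩)).ne'

theorem eventually_maxPow_le_csr (hirr : Irred A) (hvis : Visualized A) (he : eigen A = 1)
    (l : ℕ) (i j : ι) :
    ∀ᶠ r in atTop, r ≡ l [MOD gam A] → maxPow A r i j ≤ csr A l i j := by
  by_cases h : csr A l i j = 0
  · refine Eventually.of_forall fun r hr => ?_
    by_contra hne
    exact csr_ne_zero hirr hvis he hr (fun h0 => hne (by simp [h0])) h
  · filter_upwards [eventually_maxPow_noncriticalPart_lt hvis.1 he (pos_iff_ne_zero.2 h)]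
      with r hr hmod
    rcases maxPow_le_noncriticalPart_or (A := A) r i j with hle | ⟨c, hc, a, b, rfl, hle⟩
    · exact hle.trans (hr i j).le
    · exact hle.trans (maxPow_mul_le_csr hvis he hmod i j ⟨c, hc⟩)

theorem eventually_maxPow_eq_csr (hirr : Irred A) (hvis : Visualized A) (he : eigen A = 1)
    (l : ℕ) : ∀ᶠ r in atTop, r ≡ l [MOD gam A] → maxPow A r = csr A l := by
  have h : ∀ᶠ r in atTop, ∀ i j, r ≡ l [MOD gam A] → maxPow A r i j = csr A l i j := by
    refine eventually_all.2 fun i => eventually_all.2 fun j => ?_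
    filter_upwards [eventually_maxPow_le_csr hirr hvis he l i j, eventually_csr_le hvis he l i j]
      with r h₁ h₂ hr
    exact le_antisymm (h₁ hr) (h₂ hr)
  filter_upwards [h] with r hr hmod
  ext i j
  rw [hr i j hmod]

theorem exists_isTransient (hirr : Irred A) (hvis : Visualized A) (he : eigen A = 1) :
    ∃ T, IsTransient A T := by
  -- The threshold depends on `l`, but representatives below `γ` suffice.
  have h : ∀ᶠ r in atTop, ∀ l : Fin (gam A), r ≡ l [MOD gam A] → maxPow A r = csr A l :=
    eventually_all.2 fun l => eventually_maxPow_eq_csr hirr hvis he l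
  obtain ⟨T, hT⟩ := eventually_atTop.1 h
  have hT' : ∀ r ≥ T, maxPow A r = csr A (r % gam A) := fun r hr =>
    hT r hr ⟨r % gam A, Nat.mod_lt r gam_pos⟩ (Nat.mod_modEq r _).symm
  refine ⟨T, fun t ht => ?_, fun r hr => ?_⟩
  · rw [hT' _ ht, Nat.mul_mod_left, csr_zero hvis.1 he]
  · rw [hT' _ hr, hT' _ (by omega), Nat.add_mod_right]

theorem IsTransient.maxPow_add_mul_gam {T : ℕ} (hT : IsTransient A T) {r : ℕ} (hr : T ≤ r)
    (m : ℕ) : maxPow A (r + m * gam A) = maxPow A r := by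
  induction m with
  | zero => simp
  | succ m ih => rw [Nat.succ_mul, ← add_assoc, hT.2 _ (by omega), ih]

theorem isTransient_transient (h : ∃ T, IsTransient A T) : IsTransient A (transient A) :=
  Nat.sInf_mem h

end CSR

end MaxAlg

/-- CSR-representation of the periodic powers of an irreducible definite visualized matrix. The
first part says that the transient `T(A)` exists, the second and third that `C` and `R` may
equivalently be extracted from the Kleene star of `A^γ`. -/
theorem theorem5p2 (n : ℕ) (A : Matrix (Fin n) (Fin n) ℝ≥0)
    (hirr : MaxAlg.Irred A) (hdef : MaxAlg.Definite A) (hvis : MaxAlg.Visualized A) :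
    (∃ T : ℕ, MaxAlg.IsTransient A T) ∧
    MaxAlg.matC A =
      MaxAlg.criticalColumns A (MaxAlg.kleeneStar (MaxAlg.maxPow A (MaxAlg.gam A))) ∧
    MaxAlg.matR A =
      MaxAlg.criticalRows A (MaxAlg.kleeneStar (MaxAlg.maxPow A (MaxAlg.gam A))) ∧
    ∀ r l : ℕ, MaxAlg.transient A ≤ r → r ≡ l [MOD MaxAlg.gam A] →
      MaxAlg.maxPow A r =
        MaxAlg.maxMul (MaxAlg.maxMul (MaxAlg.matC A) (MaxAlg.maxPow (MaxAlg.matS A) l))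
          (MaxAlg.matR A) := by
  have hT := MaxAlg.exists_isTransient hirr hvis hdef
  refine ⟨hT, ?_, ?_, fun r l hr hmod => ?_⟩
  · ext i c
    exact congrArg _ (MaxAlg.matC_apply hvis.1 hdef i c)
  · ext c j
    exact congrArg _ (MaxAlg.matR_apply hvis.1 hdef c j)
  · obtain ⟨N, hN⟩ := Filter.eventually_atTop.1
      (MaxAlg.eventually_maxPow_eq_csr hirr hvis hdef l)
    -- Since `γ ≥ 1`, adding `N` periods to `r` passes the threshold `N`, which may exceed `T(A)`.
    rw [← (MaxAlg.isTransient_transient hT).maxPow_add_mul_gam hr N]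
    refine hN _ ?_ ?_
    · exact (Nat.le_mul_of_pos_right N MaxAlg.gam_pos).trans (Nat.le_add_left _ _)
    · refine Nat.ModEq.trans ?_ hmod
      simp [Nat.ModEq]
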